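/- For a profinite group $G$ put $H^i(G)=H^i(G,\mathbb{Z}/2)$ (continuous cohomology with trivial action; $H^1(G)$ is the group of continuous homomorphisms $G\to\mathbb{Z}/2$), and let $\beta_G\colon H^1(G)\to H^2(G)$ be the Bockstein homomorphism, i.e. the connecting homomorphism of $0\to\mathbb{Z}/2\to\mathbb{Z}/4\to\mathbb{Z}/2\to 0$. Say that $G$ has *Galois relation type* (with respect to $q=p=2$) if (i) the kernel of the homomorphism $\cup\colon H^1(G)\otimes_{\mathbb{Z}}H^1(G)\to H^2(G)$ induced by the cup product is generated, as an abelian group, by elements of the form $\psi\otimes\psi'$ with $\psi,\psi'\in H^1(G)$; (ii) there is $\xi\in H^1(G)$ such that $\psi\cup\xi+\beta_G(\psi)=0$ for every $\psi\in H^1(G)$; and (iii) the natural map $H^1(G,\mathbb{Z}/q)\to H^1(G,\mathbb{Z}/p^i)$ is surjective for all $i\ge 1$ with $p^i\mid q$ (which holds automatically for $q=p=2$). Let $G^{(1)}=G$, and for $i\ge 1$ let $G^{(i+1)}$ be the closed subgroup of $G$ generated by all $h^2$ and all $[h,g]=h^{-1}g^{-1}hg$ with $h\in G^{(i)}$, $g\in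 G$. **Corollary 11.3.** Let $G$ be a profinite group of Galois relation type with respect to $q=p=2$. Then $G^{(3)}$ is the intersection of all open normal subgroups $N$ of $G$ such that $G/N$ is isomorphic to one of the groups $1$, $\mathbb{Z}/2$, $\mathbb{Z}/4$, $D_4$, where $D_4$ is the dihedral group of order $8$. -/

import Mathlib

open scoped TensorProduct

noncomputable section

namespace ProfiniteCohomology

/-- The first cohomology group of a topological group `G` with coefficients in the trivial discrete
module `ℤ/q`: the group of continuous homomorphisms `G → ℤ/q`. -/
def H1 (q : ℕ) (G : Type*) [Group G] [TopologicalSpace G] : Type _ :=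
  Additive G →ₜ+ ZMod q

/-- The group structure of `H1 q G` is pointwise addition. -/
instance H1.instAddCommGroup (q : ℕ) (G : Type*) [Group G] [TopologicalSpace G] :
    AddCommGroup (H1 q G) :=
  inferInstanceAs (AddCommGroup (Additive G →ₜ+ ZMod q))

variable (q : ℕ) (G : Type*) [Group G] [TopologicalSpace G]

namespace H1

variable {q G}

/-- The value of a continuous homomorphism `G → ℤ/q` at a group element. -/
def val (ψ : H1 q G) (g : G) : ZMod q :=
  ContinuousAddMonoidHom.toAddMonoidHom ψ (Additive.ofMul g)

lemma val_mul (ψ : H1 q G) (g h : G) : ψ.val (g * h) = ψ.val g + ψ.val h :=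
  map_add (ContinuousAddMonoidHom.toAddMonoidHom ψ) (Additive.ofMul g) (Additive.ofMul h)

lemma val_add (ψ ψ' : H1 q G) (g : G) : (ψ + ψ').val g = ψ.val g + ψ'.val g := rfl

lemma continuous_val (ψ : H1 q G) : Continuous ψ.val :=
  (ContinuousAddMonoidHom.continuous_toFun ψ).comp continuous_ofMul

lemma ext {ψ ψ' : H1 q G} (h : ∀ g, ψ.val g = ψ'.val g) : ψ = ψ' :=
  ContinuousAddMonoidHom.ext fun x => h x.toMul

/-- The continuous homomorphism with a given underlying function. -/
def mk (f : G → ZMod q) (hf : Continuous f) (hmul : ∀ g h, f (g * h) = f g + f h) : H1 q G :=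
  { toAddMonoidHom := AddMonoidHom.mk' (fun x : Additive G => f x.toMul)
      (fun x y => hmul x.toMul y.toMul)
    continuous_toFun := hf.comp continuous_toMul }

lemma val_mk (f : G → ZMod q) (hf : Continuous f) (hmul : ∀ g h, f (g * h) = f g + f h) (g : G) :
    (mk f hf hmul).val g = f g := rfl

/-- Reduction of coefficients `H¹(G, ℤ/q) → H¹(G, ℤ/m)` for `m ∣ q`. -/
def reduce {m : ℕ} (h : m ∣ q) (ψ : H1 q G) : H1 m G :=
  mk (fun g => ZMod.castHom h (ZMod m) (ψ.val g))
    ((continuous_of_discreteTopology (f := ZMod.castHom h (ZMod m))).comp ψ.continuous_val)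
    (fun g k => by rw [val_mul, map_add])

end H1

/-- The continuous (inhomogeneous) 2-cocycles of `G` with values in the trivial discrete
module `ℤ/q`. -/
def Z2 : AddSubgroup C(G × G, ZMod q) where
  carrier := {f | ∀ g h k : G, f (h, k) - f (g * h, k) + f (g, h * k) - f (g, h) = 0}
  zero_mem' := fun _ _ _ => by simp
  add_mem' := by
    intro a b ha hb g h k
    have h1 := ha g h k
    have h2 := hb g h k
    simp only [ContinuousMap.add_apply]
    linear_combination h1 + h2
  neg_mem' := by
    intro a ha g h k
    have h1 := ha g h k
    simp only [ContinuousMap.neg_apply]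
    linear_combination -h1

/-- The continuous 2-coboundaries of `G` with values in the trivial discrete module `ℤ/q`: the
functions `(g, h) ↦ c h - c (g * h) + c g` with `c` a continuous 1-cochain. -/
def B2 : AddSubgroup C(G × G, ZMod q) where
  carrier := {f | ∃ c : C(G, ZMod q), ∀ g h : G, f (g, h) = c h - c (g * h) + c g}
  zero_mem' := ⟨0, fun _ _ => by simp⟩
  add_mem' := by
    rintro a b ⟨c, hc⟩ ⟨d, hd⟩
    refine ⟨c + d, fun g h => ?_⟩
    simp only [ContinuousMap.add_apply, hc, hd]
    ring
  neg_mem' := by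
    rintro a ⟨c, hc⟩
    refine ⟨-c, fun g h => ?_⟩
    simp only [ContinuousMap.neg_apply, hc]
    ring

/-- The second continuous cohomology group of `G` with coefficients in the trivial discrete
module `ℤ/q`: continuous 2-cocycles modulo continuous 2-coboundaries. -/
def H2 : Type _ := Z2 q G ⧸ (B2 q G).addSubgroupOf (Z2 q G)

instance H2.instAddCommGroup : AddCommGroup (H2 q G) :=
  inferInstanceAs (AddCommGroup (Z2 q G ⧸ (B2 q G).addSubgroupOf (Z2 q G)))

/-- The cohomology class of a continuous 2-cocycle. -/
def H2.mk : Z2 q G →+ H2 q G := QuotientAddGroup.mk' ((B2 q G).addSubgroupOf (Z2 q G))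

variable {q G}

/-- The 2-cocycle `(g, h) ↦ ψ g * ψ' h`, which represents the cup product of `ψ` and `ψ'`. -/
def cupCocycle (ψ ψ' : H1 q G) : Z2 q G where
  val := ⟨fun x => ψ.val x.1 * ψ'.val x.2,
    (continuous_of_discreteTopology (f := fun y : ZMod q × ZMod q => y.1 * y.2)).comp
      ((ψ.continuous_val.comp continuous_fst).prodMk (ψ'.continuous_val.comp continuous_snd))⟩
  property := by
    intro g h k
    simp only [ContinuousMap.coe_mk, H1.val_mul]
    ring

/-- The cup product `H¹(G, ℤ/q) × H¹(G, ℤ/q) → H²(G, ℤ/q)`. -/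
def cup (ψ ψ' : H1 q G) : H2 q G := H2.mk q G (cupCocycle ψ ψ')

lemma cup_add_left (a b c : H1 q G) : cup (a + b) c = cup a c + cup b c := by
  rw [cup, cup, cup, ← map_add]
  refine congrArg (H2.mk q G) (Subtype.ext (ContinuousMap.ext fun x => ?_))
  exact add_mul (a.val x.1) (b.val x.1) (c.val x.2)

lemma cup_add_right (a b c : H1 q G) : cup a (b + c) = cup a b + cup a c := by
  rw [cup, cup, cup, ← map_add]
  refine congrArg (H2.mk q G) (Subtype.ext (ContinuousMap.ext fun x => ?_))
  exact mul_add (a.val x.1) (b.val x.2) (c.val x.2)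

variable (q G) in
/-- The homomorphism `H¹(G, ℤ/q) ⊗_ℤ H¹(G, ℤ/q) → H²(G, ℤ/q)` induced by the cup product. -/
def cupHom : H1 q G ⊗[ℤ] H1 q G →+ H2 q G :=
  TensorProduct.liftAddHom
    (AddMonoidHom.mk' (fun a => AddMonoidHom.mk' (cup a) (cup_add_right a))
      (fun a b => AddMonoidHom.ext fun c => cup_add_left a b c))
    (fun n a b => by rw [map_zsmul, map_zsmul, AddMonoidHom.zsmul_apply])

lemma cupHom_tmul (a b : H1 q G) : cupHom q G (a ⊗ₜ b) = cup a b := rfl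

/-- The carry `⌊(a + b) / q⌋` in the addition of the standard representatives in `{0, …, q - 1}`
of two residues modulo `q`. -/
def carry (a b : ZMod q) : ZMod q := ((a.val + b.val) / q : ℕ)

/-- The carry describes the failure of the section `ZMod.val` of `ℤ/q² → ℤ/q` to be additive:
its image under the embedding `ℤ/q → ℤ/q²`, `x ↦ q * x`, is the coboundary of that section. -/
lemma carry_spec [NeZero q] (a b : ZMod q) :
    ((q * (carry a b).val : ℕ) : ZMod (q * q)) =
      (b.val : ZMod (q * q)) - ((a + b).val : ZMod (q * q)) + (a.val : ZMod (q * q)) := by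
  have ha := ZMod.val_lt a
  have hb := ZMod.val_lt b
  have h : q * (carry a b).val + (a + b).val = a.val + b.val := by
    rcases Nat.lt_or_ge 1 q with h1 | h1
    · have hlt : (a.val + b.val) / q < q := by
        rw [Nat.div_lt_iff_lt_mul (by omega)]
        nlinarith
      rw [carry, ZMod.val_natCast, Nat.mod_eq_of_lt hlt, ZMod.val_add]
      exact Nat.div_add_mod _ _
    · obtain rfl : q = 1 := by omega
      have hc := ZMod.val_lt (a + b)
      have hd := ZMod.val_lt (carry a b)
      omega
  have h' := congrArg (Nat.cast : ℕ → ZMod (q * q)) h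
  push_cast at h' ⊢
  linear_combination h'

lemma carry_cocycle [NeZero q] (a b c : ZMod q) :
    carry b c - carry (a + b) c + carry a (b + c) - carry a b = 0 := by
  have hq : 0 < q := NeZero.pos q
  have key : (b.val + c.val) / q + (a.val + (b + c).val) / q =
      ((a + b).val + c.val) / q + (a.val + b.val) / q := by
    rw [ZMod.val_add, ZMod.val_add]
    have e1 : (b.val + c.val) / q + (a.val + (b.val + c.val) % q) / q
        = (a.val + b.val + c.val) / q := by
      rw [add_comm, ← Nat.add_mul_div_left _ _ hq]
      congr 1
      have := Nat.mod_add_div (b.val + c.val) q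
      omega
    have e2 : ((a.val + b.val) % q + c.val) / q + (a.val + b.val) / q
        = (a.val + b.val + c.val) / q := by
      rw [← Nat.add_mul_div_left _ _ hq]
      congr 1
      have := Nat.mod_add_div (a.val + b.val) q
      omega
    rw [e1, e2]
  have h := congrArg (Nat.cast : ℕ → ZMod q) key
  rw [Nat.cast_add, Nat.cast_add] at h
  simp only [carry]
  linear_combination h

/-- The Bockstein homomorphism `β_G : H¹(G, ℤ/q) → H²(G, ℤ/q)`, i.e. the connecting map of
`0 → ℤ/q → ℤ/q² → ℤ/q → 0`. One lifts `ψ` to the continuous 1-cochain `g ↦ (ψ g).val` with values in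
`ℤ/q²`; its coboundary is `q` times the cocycle `(g, h) ↦ carry (ψ g) (ψ h)`. -/
def bockstein [NeZero q] (ψ : H1 q G) : H2 q G :=
  H2.mk q G
    { val := ⟨fun x => carry (ψ.val x.1) (ψ.val x.2),
        (continuous_of_discreteTopology (f := fun y : ZMod q × ZMod q => carry y.1 y.2)).comp
          ((ψ.continuous_val.comp continuous_fst).prodMk (ψ.continuous_val.comp continuous_snd))⟩
      property := by
        intro g h k
        simp only [ContinuousMap.coe_mk, H1.val_mul]
        exact carry_cocycle _ _ _ }

variable (q G) in
/-- `G` has Galois relation type with respect to the prime power `q`. In the third condition the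
divisors of `q = p ^ d` are the `p ^ i` with `0 ≤ i ≤ d`, and the condition is empty for `i = 0`. -/
structure IsGaloisRelationType [NeZero q] : Prop where
  /-- The kernel of the cup product is generated, as an abelian group, by pure tensors. -/
  ker_cup : AddSubgroup.closure
      {t : H1 q G ⊗[ℤ] H1 q G | (∃ ψ ψ' : H1 q G, t = ψ ⊗ₜ[ℤ] ψ') ∧ cupHom q G t = 0} =
    (cupHom q G).ker
  /-- The Bockstein homomorphism is, up to sign, the cup product with a fixed class. -/
  exists_xi : ∃ ξ : H1 q G, ∀ ψ : H1 q G, cup ψ ξ + bockstein ψ = 0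
  /-- The reduction maps on first cohomology are surjective. -/
  reduce_surjective : ∀ (m : ℕ) (h : m ∣ q),
    Function.Surjective (H1.reduce h : H1 q G → H1 m G)

end ProfiniteCohomology

/-- The descending `q`-central sequence of a topological group, with the usual indexing starting
at `1`: `G⁽¹⁾ = G`, and `G⁽ⁱ⁺¹⁾` is the closed subgroup generated by all `h ^ q` and all
`h⁻¹ * g⁻¹ * h * g` with `h ∈ G⁽ⁱ⁾` and `g ∈ G`. (The index `0` is not used.) -/
def descendingCentral (q : ℕ) (G : Type*) [Group G] [TopologicalSpace G] [IsTopologicalGroup G] :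
    ℕ → Subgroup G
  | 0 => ⊤
  | 1 => ⊤
  | i + 2 => (Subgroup.closure
      ({x | ∃ h ∈ descendingCentral q G (i + 1), x = h ^ q} ∪
        {x | ∃ h ∈ descendingCentral q G (i + 1), ∃ g : G,
          x = h⁻¹ * g⁻¹ * h * g})).topologicalClosure

end

-- In `1`, `ℤ/2`, `ℤ/4` and `D₄`, squares and commutators are central with trivial square, so the
-- third term of the series dies in each of these quotients.
--
-- Conversely, let `g ∉ G⁽³⁾` and choose an open normal `N ⊇ G⁽³⁾` missing `g`. Then `Q = G/N` is a
-- central extension of an elementary abelian group `V` by an elementary abelian group `K`, the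
-- image of `G⁽²⁾`. If `g` lies outside `K`, a character of `V` detects it. Otherwise a character
-- `θ` of `K` does, and `exists_extension_bilinear` extends `θ` to a cochain on `Q` whose coboundary
-- is a bilinear form on `V`, hence a sum of products of characters (`exists_cochain_ne_zero`).
--
-- This sum is in the kernel of the cup product. As the kernel is generated by pure tensors, some
-- cochain `c` with coboundary a single `ψ ∪ ψ'` is already nonzero at `g`
-- (`eq_zero_of_forall_cup_eq_zero`). The triple `(ψ, ψ', c)` is a homomorphism to the unitriangular
-- `3 × 3` matrices over `ZMod 2`, that is, to `D₄`; its image is `ℤ/4` or `D₄`, unless `ψ ∪ ψ'`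
-- vanishes as a cocycle and `c` is itself a character (`exists_quotient_of_cup`).

universe u

/-! ### Characters of elementary abelian quotients -/

/-- A group modulo a subgroup containing all squares is a vector space over the field with two
elements. -/
theorem exists_zmodTwo_quotient {E : Type u} [Group E] (D : Subgroup E) (hD : ∀ x : E, x * x ∈ D) :
    ∃ (V : Type u) (_ : AddCommGroup V) (_ : Module (ZMod 2) V) (π : E → V),
      Function.Surjective π ∧ (∀ x y, π (x * y) = π x + π y) ∧ ∀ x, π x = 0 ↔ x ∈ D := by
  have hn : D.Normal := ⟨fun d hd x => by
    have h : x * d * x⁻¹ = ((x * d) * (x * d)) * (d⁻¹ * (x⁻¹ * x⁻¹)) := by group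
    rw [h]
    exact D.mul_mem (hD _) (D.mul_mem (D.inv_mem hd) (hD _))⟩
  have hsq : ∀ y : E ⧸ D, y * y = 1 := by
    intro y
    obtain ⟨x, rfl⟩ := QuotientGroup.mk_surjective y
    exact (QuotientGroup.eq_one_iff (x * x)).mpr (hD x)
  have hinv : ∀ y : E ⧸ D, y⁻¹ = y := fun y => inv_eq_of_mul_eq_one_left (hsq y)
  let : CommGroup (E ⧸ D) :=
    { (inferInstance : Group (E ⧸ D)) with
      mul_comm := fun a b => by rw [← hinv (a * b), mul_inv_rev, hinv, hinv] }
  let : Module (ZMod 2) (Additive (E ⧸ D)) :=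
    AddCommGroup.zmodModule (n := 2) fun x => by
      rw [two_nsmul]
      exact congrArg Additive.ofMul (hsq x.toMul)
  refine ⟨Additive (E ⧸ D), inferInstance, inferInstance,
    fun x => Additive.ofMul (x : E ⧸ D), ?_, fun x y => rfl, fun x => ?_⟩
  · intro v
    obtain ⟨x, hx⟩ := QuotientGroup.mk_surjective v.toMul
    exact ⟨x, congrArg Additive.ofMul hx⟩
  · exact QuotientGroup.eq_one_iff x

/-- Characters of order two separate points from subgroups containing all squares. -/
theorem exists_zmodTwo_character {E : Type*} [Group E] (D : Subgroup E) (hD : ∀ x : E, x * x ∈ D)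
    {e : E} (he : e ∉ D) :
    ∃ χ : E → ZMod 2, (∀ x y, χ (x * y) = χ x + χ y) ∧ (∀ d ∈ D, χ d = 0) ∧ χ e = 1 := by
  obtain ⟨V, _, _, π, -, hπ, hker⟩ := exists_zmodTwo_quotient D hD
  have h0 : π e ≠ 0 := fun h => he ((hker e).mp h)
  obtain ⟨φ, hφ⟩ : ∃ φ : Module.Dual (ZMod 2) V, φ (π e) ≠ 0 := by
    by_contra! h
    exact h0 ((Module.forall_dual_apply_eq_zero_iff (ZMod 2) _).mp h)
  refine ⟨fun x => φ (π x), fun x y => by simp [hπ], fun d hd => by simp [(hker d).mpr hd],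
    (by decide : ∀ t : ZMod 2, t ≠ 0 → t = 1) _ hφ⟩

/-! ### Central extensions of elementary abelian 2-groups and quadratic forms -/

section CentralExtension

variable {Q V : Type*} [Group Q] [AddCommGroup V] [Module (ZMod 2) V] {K : Subgroup Q} {π : Q → V}

/-- The quadratic form induced by squaring on the quotient of a group by a central elementary
abelian subgroup containing all squares. -/
theorem exists_squaring_form (hsurj : Function.Surjective π)
    (hπ : ∀ x y, π (x * y) = π x + π y) (hker : ∀ x, π x = 0 ↔ x ∈ K)
    (hcentral : ∀ k ∈ K, ∀ x, k * x = x * k) (hK : ∀ k ∈ K, k * k = 1)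
    (θ : Q → ZMod 2) (hθ : ∀ k ∈ K, ∀ l ∈ K, θ (k * l) = θ k + θ l) :
    ∃ q : QuadraticMap (ZMod 2) V (ZMod 2), ∀ x, q (π x) = θ (x * x) := by
  have h1 : π 1 = 0 := (hker 1).mpr K.one_mem
  have hθ1 : θ 1 = 0 := by simpa using hθ 1 K.one_mem 1 K.one_mem
  have hV : ∀ v : V, v + v = 0 := fun v => by
    rw [← two_nsmul, ← Nat.cast_smul_eq_nsmul (ZMod 2)]
    exact zero_smul _ v
  have hinv : ∀ x, π x⁻¹ = π x := fun x => by
    have h := hπ x⁻¹ x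
    rw [inv_mul_cancel, h1] at h
    rw [← add_zero (π x⁻¹), ← hV (π x), ← add_assoc, ← h, zero_add]
  have hsq : ∀ x, x * x ∈ K := fun x => (hker _).mp (by rw [hπ, hV])
  have hcomm : ∀ x y, x⁻¹ * y * x * y⁻¹ ∈ K := fun x y => (hker _).mp (by
    rw [hπ, hπ, hπ, hinv, hinv]
    have e : π x + π y + π x + π y = (π x + π x) + (π y + π y) := by abel
    rw [e, hV, hV, add_zero])
  have hq : ∀ x y, π x = π y → θ (x * x) = θ (y * y) := by
    intro x y h
    have hk : y⁻¹ * x ∈ K := (hker _).mp (by rw [hπ, hinv, h, hV])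
    have e : x * x = y * y * ((y⁻¹ * x) * (y⁻¹ * x)) := by
      have hc := hcentral _ hk y
      calc x * x = y * ((y⁻¹ * x) * y) * (y⁻¹ * x) := by group
        _ = _ := by rw [hc]; group
    rw [e, hK _ hk, mul_one]
  set q : V → ZMod 2 := fun v =>
    θ (Function.surjInv hsurj v * Function.surjInv hsurj v) with hqdef
  have hqπ : ∀ x, q (π x) = θ (x * x) := fun x => hq _ _ (Function.surjInv_eq hsurj _)
  -- The polar form is the commutator pairing, by expanding `(xy)²`; it is biadditive because
  -- commutators are central.
  have hpolar : ∀ x y, QuadraticMap.polar q (π x) (π y) = θ (x⁻¹ * y * x * y⁻¹) := by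
    intro x y
    rw [QuadraticMap.polar, ← hπ, hqπ, hqπ, hqπ]
    have e : x * y * (x * y) = (x * x) * ((x⁻¹ * y * x * y⁻¹) * (y * y)) := by group
    rw [e, hθ _ (hsq x) _ (K.mul_mem (hcomm x y) (hsq y)), hθ _ (hcomm x y) _ (hsq y)]
    ring
  have hpolar_add : ∀ u v w : V, QuadraticMap.polar q (u + v) w =
      QuadraticMap.polar q u w + QuadraticMap.polar q v w := by
    intro u v w
    obtain ⟨x, rfl⟩ := hsurj u
    obtain ⟨y, rfl⟩ := hsurj v
    obtain ⟨z, rfl⟩ := hsurj w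
    rw [← hπ, hpolar, hpolar, hpolar, ← hθ _ (hcomm x z) _ (hcomm y z)]
    congr 1
    calc (x * y)⁻¹ * z * (x * y) * z⁻¹
        = y⁻¹ * (x⁻¹ * z * x * z⁻¹) * (z * y * z⁻¹) := by group
      _ = (x⁻¹ * z * x * z⁻¹) * y⁻¹ * (z * y * z⁻¹) := by rw [hcentral _ (hcomm x z) y⁻¹]
      _ = _ := by group
  have hq0 : q 0 = 0 := by rw [← h1, hqπ, mul_one, hθ1]
  have ha : ∀ a : ZMod 2, a = 0 ∨ a = 1 := by decide
  refine ⟨QuadraticMap.ofPolar q ?_ hpolar_add ?_, hqπ⟩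
  · intro a v
    rcases ha a with rfl | rfl
    · simp [hq0]
    · simp
  · intro a u v
    rcases ha a with rfl | rfl
    · simp [QuadraticMap.polar, hq0]
    · simp

/-- A character of a central elementary abelian subgroup with elementary abelian quotient extends
to a function whose coboundary is a bilinear form. -/
theorem exists_extension_bilinear (hsurj : Function.Surjective π)
    (hπ : ∀ x y, π (x * y) = π x + π y) (hker : ∀ x, π x = 0 ↔ x ∈ K)
    (hcentral : ∀ k ∈ K, ∀ x, k * x = x * k) (hK : ∀ k ∈ K, k * k = 1)
    (θ : Q → ZMod 2) (hθ : ∀ k ∈ K, ∀ l ∈ K, θ (k * l) = θ k + θ l) :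
    ∃ (B : LinearMap.BilinMap (ZMod 2) V (ZMod 2)) (f : Q → ZMod 2),
      (∀ x y, f x + f y = f (x * y) + B (π x) (π y)) ∧ ∀ k ∈ K, f k = θ k := by
  obtain ⟨q, hq⟩ := exists_squaring_form hsurj hπ hker hcentral hK θ hθ
  -- Since 2 is not invertible, `B` cannot be taken symmetric in general; only its diagonal `B(v, v)
  -- = q(v)` matters.
  obtain ⟨B, hB⟩ := LinearMap.BilinMap.toQuadraticMap_surjective q
  have h2 : ∀ a : ZMod 2, a + a = 0 := by decide
  have hBq : ∀ x, B (π x) (π x) = θ (x * x) := fun x => by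
    rw [← hq, ← hB]; rfl
  have hinv : ∀ x, π x⁻¹ = - π x := fun x => by
    have h := hπ x⁻¹ x
    rw [inv_mul_cancel, (hker 1).mpr K.one_mem] at h
    exact eq_neg_of_add_eq_zero_left h.symm
  have hθ1 : θ 1 = 0 := by simpa using hθ 1 K.one_mem 1 K.one_mem
  -- `E` is the central extension of `Q` by `ZMod 2` with cocycle `B`, and `D` below is the graph of
  -- `θ` over `K`. The choice of `B` puts all squares of `E` into `D`, so a character of `E` killing
  -- `D` but not `(1, 1)` exists; it splits the extension and yields `f`.
  let E := Q × ZMod 2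
  let : Mul E := ⟨fun a b => (a.1 * b.1, a.2 + b.2 + B (π a.1) (π b.1))⟩
  let : One E := ⟨(1, 0)⟩
  let : Inv E := ⟨fun a => (a.1⁻¹, a.2 + B (π a.1) (π a.1))⟩
  have mul_def : ∀ a b : E, a * b = (a.1 * b.1, a.2 + b.2 + B (π a.1) (π b.1)) := fun _ _ => rfl
  have one_def : (1 : E) = (1, 0) := rfl
  have inv_def : ∀ a : E, a⁻¹ = (a.1⁻¹, a.2 + B (π a.1) (π a.1)) := fun _ => rfl
  let : Group E := Group.ofLeftAxioms
    (fun a b c => by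
      simp only [mul_def, mul_assoc, hπ, map_add, LinearMap.add_apply]
      congr 1
      ring)
    (fun a => by
      simp [mul_def, one_def, (hker 1).mpr K.one_mem])
    (fun a => by
      simp only [mul_def, one_def, inv_def, inv_mul_cancel, hinv, map_neg, LinearMap.neg_apply]
      congr 1
      linear_combination h2 a.2)
  let D : Subgroup E :=
    { carrier := {a | a.1 ∈ K ∧ a.2 = θ a.1}
      one_mem' := ⟨K.one_mem, hθ1.symm⟩
      mul_mem' := by
        rintro a b ⟨ha, ha'⟩ ⟨hb, hb'⟩
        refine ⟨K.mul_mem ha hb, ?_⟩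
        simp only [mul_def]
        rw [hθ _ ha _ hb, ha', hb', (hker _).mpr ha]
        simp
      inv_mem' := by
        rintro a ⟨ha, ha'⟩
        refine ⟨K.inv_mem ha, ?_⟩
        simp only [inv_def]
        rw [ha', (hker _).mpr ha, inv_eq_of_mul_eq_one_left (hK _ ha)]
        simp }
  have hD : ∀ a : E, a * a ∈ D := fun a => by
    refine ⟨(hker _).mp ?_, ?_⟩
    · simp only [mul_def]
      rw [hπ, ← two_nsmul, ← Nat.cast_smul_eq_nsmul (ZMod 2)]
      exact zero_smul _ _
    · simp only [mul_def, h2, zero_add, hBq]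
  have he : ((1, 1) : E) ∉ D := fun h => by
    have h' : (1 : ZMod 2) = θ 1 := h.2
    rw [hθ1] at h'
    exact one_ne_zero h'
  obtain ⟨χ, hχ, hχD, hχe⟩ := exists_zmodTwo_character D hD he
  have hχ1 : ∀ (x : Q) (t : ZMod 2), χ (x, t) = χ (x, 0) + t := by
    intro x t
    have ht : χ (1, t) = t := by
      have : t = 0 ∨ t = 1 := by revert t; decide
      rcases this with rfl | rfl
      · exact hχD (1, 0) D.one_mem
      · exact hχe
    have e : ((x, t) : E) = (x, 0) * (1, t) := by
      simp [mul_def, (hker 1).mpr K.one_mem]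
    rw [e, hχ, ht]
  refine ⟨B, fun x => χ (x, 0), fun x y => ?_, fun k hk => ?_⟩
  · rw [← hχ, ← hχ1]
    simp [mul_def]
  · have h := hχD (k, θ k) ⟨hk, rfl⟩
    rw [hχ1] at h
    have h3 := h2 (θ k)
    linear_combination h - h3

end CentralExtension

/-! ### The dihedral group as unitriangular matrices -/

/-- The element of the dihedral group of order `8` corresponding to the upper unitriangular matrix
over `ZMod 2` with entries `a`, `b` above the diagonal and `c` in the corner. -/
def dihedralOfUnitriangular (a b c : ZMod 2) : DihedralGroup 4 :=
  (DihedralGroup.r 2) ^ c.val * (DihedralGroup.sr 0) ^ b.val * (DihedralGroup.sr 1) ^ a.val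

/-- Matrix multiplication; the corner term `a * b'` is the cup product cocycle. -/
theorem dihedralOfUnitriangular_mul (a b c a' b' c' : ZMod 2) :
    dihedralOfUnitriangular a b c * dihedralOfUnitriangular a' b' c' =
      dihedralOfUnitriangular (a + a') (b + b') (c + c' + a * b') := by
  revert a b c a' b' c'
  decide

theorem dihedralOfUnitriangular_eq_one_iff (a b c : ZMod 2) :
    dihedralOfUnitriangular a b c = 1 ↔ a = 0 ∧ b = 0 ∧ c = 0 := by
  revert a b c
  decide

/-- The square of such a matrix has corner entry `1 * 1` and zeros next to the diagonal, so it is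
the nontrivial central element. -/
theorem orderOf_dihedralOfUnitriangular (c : ZMod 2) :
    orderOf (dihedralOfUnitriangular 1 1 c) = 4 := by
  have h : dihedralOfUnitriangular 1 1 c ^ 2 ^ 1 ≠ 1 ∧
      dihedralOfUnitriangular 1 1 c ^ 2 ^ (1 + 1) = 1 := by
    revert c
    decide
  exact orderOf_eq_prime_pow h.1 h.2

/-- A subgroup of the dihedral group of order `8` with an element of order `4` is cyclic of order
`4` or the whole group. -/
theorem nonempty_mulEquiv_of_orderOf_eq_four (H : Subgroup (DihedralGroup 4)) {x : DihedralGroup 4}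
    (hx : x ∈ H) (hord : orderOf x = 4) :
    Nonempty (H ≃* Multiplicative (ZMod 4)) ∨ Nonempty (H ≃* DihedralGroup 4) := by
  have hord' : orderOf (⟨x, hx⟩ : H) = 4 := by rw [Subgroup.orderOf_mk, hord]
  have h8 : Nat.card (DihedralGroup 4) = 8 := DihedralGroup.nat_card
  obtain ⟨m, hm⟩ : 4 ∣ Nat.card H :=
    hord'.symm.dvd.trans (orderOf_dvd_natCard _)
  obtain ⟨n, hn⟩ : Nat.card H ∣ 8 := h8 ▸ Subgroup.card_subgroup_dvd_card H
  have hm2 : m * n = 2 := by rw [hm, mul_assoc] at hn; omega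
  have hmle : m ≤ 2 := Nat.le_of_dvd two_pos ⟨n, hm2.symm⟩
  interval_cases m
  · omega
  · left
    have hcyc : IsCyclic H := isCyclic_of_orderOf_eq_card ⟨x, hx⟩ (by rw [hord', hm])
    exact ⟨mulEquivOfCyclicCardEq (by rw [hm]; simp)⟩
  · right
    have htop : H = ⊤ := Subgroup.eq_top_of_card_eq H (by rw [hm, h8])
    subst htop
    exact ⟨Subgroup.topEquiv⟩

/-! ### The descending 2-central sequence and its small quotients -/

/-- Squares and commutators are central and of order at most `2`. -/
def SquaresCommutatorsCentral (Q : Type*) [Group Q] : Prop :=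
  (∀ a c : Q, (a ^ 2) ^ 2 = 1 ∧ a ^ 2 * c = c * a ^ 2) ∧
    ∀ a b c : Q, (a⁻¹ * b⁻¹ * a * b) ^ 2 = 1 ∧
      (a⁻¹ * b⁻¹ * a * b) * c = c * (a⁻¹ * b⁻¹ * a * b)

theorem SquaresCommutatorsCentral.of_mulEquiv {Q R : Type*} [Group Q] [Group R]
    (hR : SquaresCommutatorsCentral R) (e : Q ≃* R) : SquaresCommutatorsCentral Q := by
  constructor
  · intro a c
    obtain ⟨h1, h2⟩ := hR.1 (e a) (e c)
    exact ⟨e.injective (by simpa using h1), e.injective (by simpa using h2)⟩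
  · intro a b c
    obtain ⟨h1, h2⟩ := hR.2 (e a) (e b) (e c)
    exact ⟨e.injective (by simpa using h1), e.injective (by simpa using h2)⟩

theorem SquaresCommutatorsCentral.of_forall_pow_four {Q : Type*} [CommGroup Q]
    (h : ∀ a : Q, a ^ 4 = 1) : SquaresCommutatorsCentral Q :=
  ⟨fun a c => ⟨by rw [← pow_mul, h], mul_comm _ _⟩, fun a b c => ⟨by
    rw [show a⁻¹ * b⁻¹ * a * b = 1 by rw [mul_right_comm a⁻¹, inv_mul_cancel, one_mul,
      inv_mul_cancel], one_pow], mul_comm _ _⟩⟩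

theorem squaresCommutatorsCentral_dihedral : SquaresCommutatorsCentral (DihedralGroup 4) :=
  ⟨by decide, by decide⟩

section DescendingCentral

variable {G : Type*} [Group G] [TopologicalSpace G] [IsTopologicalGroup G]

theorem descendingCentral_le {q i : ℕ} {Z : Subgroup G} (hZ : IsClosed (Z : Set G))
    (hpow : ∀ h ∈ descendingCentral q G (i + 1), h ^ q ∈ Z)
    (hcomm : ∀ h ∈ descendingCentral q G (i + 1), ∀ g : G, h⁻¹ * g⁻¹ * h * g ∈ Z) :
    descendingCentral q G (i + 2) ≤ Z := by
  rw [descendingCentral]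
  refine Subgroup.topologicalClosure_minimal _ ((Subgroup.closure_le _).mpr ?_) hZ
  rintro x (⟨h, hh, rfl⟩ | ⟨h, hh, g, rfl⟩)
  exacts [hpow h hh, hcomm h hh g]

theorem pow_mem_descendingCentral {q i : ℕ} {h : G} (hh : h ∈ descendingCentral q G (i + 1)) :
    h ^ q ∈ descendingCentral q G (i + 2) := by
  rw [descendingCentral]
  exact Subgroup.le_topologicalClosure _ (Subgroup.subset_closure (Or.inl ⟨h, hh, rfl⟩))

theorem commutator_mem_descendingCentral {q i : ℕ} {h : G}
    (hh : h ∈ descendingCentral q G (i + 1)) (g : G) :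
    h⁻¹ * g⁻¹ * h * g ∈ descendingCentral q G (i + 2) := by
  rw [descendingCentral]
  exact Subgroup.le_topologicalClosure _ (Subgroup.subset_closure (Or.inr ⟨h, hh, g, rfl⟩))

theorem isClosed_descendingCentral (q i : ℕ) :
    IsClosed (descendingCentral q G (i + 1) : Set G) := by
  cases i with
  | zero => exact isClosed_univ
  | succ i => rw [descendingCentral]; exact Subgroup.isClosed_topologicalClosure _

theorem descendingCentral_normal (q i : ℕ) : (descendingCentral q G (i + 1)).Normal := by
  induction i with
  | zero => rw [descendingCentral]; infer_instance
  | succ i ih =>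
    have hle : descendingCentral q G (i + 2) ≤ descendingCentral q G (i + 1) :=
      descendingCentral_le (isClosed_descendingCentral q i) (fun h hh => Subgroup.pow_mem _ hh q)
        fun h hh g => by
          have := ih.conj_mem h hh g⁻¹
          rw [inv_inv] at this
          rw [mul_assoc, mul_assoc, ← mul_assoc g⁻¹]
          exact Subgroup.mul_mem _ (Subgroup.inv_mem _ hh) this
    refine ⟨fun h hh g => ?_⟩
    have e : g * h * g⁻¹ = h * (h⁻¹ * g⁻¹⁻¹ * h * g⁻¹) := by group
    rw [e]
    exact Subgroup.mul_mem _ hh (commutator_mem_descendingCentral (hle hh) _)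

/-- The third term of the descending `2`-central sequence lies in every open normal subgroup whose
quotient has central squares and commutators of exponent two. -/
theorem descendingCentral_three_le (N : OpenNormalSubgroup G)
    (hN : SquaresCommutatorsCentral (G ⧸ (N : Subgroup G))) :
    descendingCentral 2 G 3 ≤ (N : Subgroup G) := by
  -- The preimage of the central elements of square one in `G ⧸ N`. It contains the open subgroup
  -- `N`, so it is closed and catches the second term.
  let Z : Subgroup G :=
    { carrier := {x | (x : G ⧸ (N : Subgroup G)) ^ 2 = 1 ∧
        ∀ c : G ⧸ (N : Subgroup G), (x : G ⧸ (N : Subgroup G)) * c = c * x}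
      one_mem' := by simp
      mul_mem' := by
        rintro a b ⟨ha, ha'⟩ ⟨hb, hb'⟩
        refine ⟨?_, fun c => ?_⟩
        · rw [QuotientGroup.mk_mul, Commute.mul_pow (ha' b), ha, hb, one_mul]
        · rw [QuotientGroup.mk_mul, mul_assoc, hb', ← mul_assoc, ha', mul_assoc]
      inv_mem' := by
        rintro a ⟨ha, ha'⟩
        refine ⟨?_, fun c => ?_⟩
        · rw [QuotientGroup.mk_inv, inv_pow, ha, inv_one]
        · exact Commute.inv_left (ha' c) }
  have hNZ : (N : Subgroup G) ≤ Z := fun x hx => by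
    have h1 : (x : G ⧸ (N : Subgroup G)) = 1 := (QuotientGroup.eq_one_iff x).mpr hx
    exact ⟨by rw [h1, one_pow], fun c => by rw [h1, one_mul, mul_one]⟩
  have hZ : IsClosed (Z : Set G) :=
    Subgroup.isClosed_of_isOpen Z (Subgroup.isOpen_mono hNZ N.isOpen')
  have h2 : descendingCentral 2 G 2 ≤ Z :=
    descendingCentral_le hZ (fun h _ => ⟨(hN.1 h 1).1, fun c => (hN.1 h c).2⟩)
      fun h _ g => ⟨(hN.2 h g 1).1, fun c => (hN.2 h g c).2⟩
  refine descendingCentral_le (Subgroup.isClosed_of_isOpen _ N.isOpen') (fun h hh => ?_)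
    fun h hh g => ?_
  · exact (QuotientGroup.eq_one_iff _).mp (h2 hh).1
  · refine (QuotientGroup.eq_one_iff _).mp ?_
    have hc := (h2 hh).2 g
    rw [QuotientGroup.mk_mul, QuotientGroup.mk_mul, QuotientGroup.mk_mul, mul_assoc, hc,
      QuotientGroup.mk_inv, QuotientGroup.mk_inv]
    group

end DescendingCentral

/-! ### From cochains trivializing cup products to quotients -/

namespace ProfiniteCohomology

section

variable {G : Type*} [Group G] [TopologicalSpace G]

/-- The kernel of a homomorphism with open kernel, as an open normal subgroup. -/
def openNormalKer {P : Type*} [Group P] (Φ : G →* P) (h : IsOpen (Φ.ker : Set G)) :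
    OpenNormalSubgroup G where
  toSubgroup := Φ.ker
  isOpen' := h
  isNormal' := inferInstance

theorem exists_quotient_zmodTwo (ψ : H1 2 G) {g : G} (hg : ψ.val g ≠ 0) :
    ∃ N : OpenNormalSubgroup G, g ∉ N ∧
      Nonempty ((G ⧸ (N : Subgroup G)) ≃* Multiplicative (ZMod 2)) := by
  have h01 : ∀ t : ZMod 2, t ≠ 0 → t = 1 := by decide
  let Φ : G →* Multiplicative (ZMod 2) :=
    MonoidHom.mk' (fun x => Multiplicative.ofAdd (ψ.val x)) fun x y => by
      rw [H1.val_mul, ofAdd_add]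
  have hker : ∀ x, x ∈ Φ.ker ↔ ψ.val x = 0 := fun x => Iff.rfl
  have hopen : IsOpen (Φ.ker : Set G) :=
    (isOpen_discrete ({0} : Set (ZMod 2))).preimage ψ.continuous_val
  have hsurj : Function.Surjective Φ := by
    intro t
    by_cases ht : t.toAdd = 0
    · exact ⟨1, by rw [map_one]; exact congrArg Multiplicative.ofAdd ht.symm⟩
    · exact ⟨g, congrArg Multiplicative.ofAdd ((h01 _ hg).trans (h01 _ ht).symm)⟩
  exact ⟨openNormalKer Φ hopen, fun h => hg ((hker g).mp h),
    ⟨QuotientGroup.quotientKerEquivOfSurjective Φ hsurj⟩⟩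

/-- A cochain whose coboundary is the cup product of two characters gives a homomorphism to the
dihedral group of order `8`. -/
theorem exists_quotient_of_cup (ψ ψ' : H1 2 G) (c : C(G, ZMod 2))
    (hc : ∀ x y, c y - c (x * y) + c x = ψ.val x * ψ'.val y) {g : G} (hg : c g ≠ 0) :
    ∃ N : OpenNormalSubgroup G, g ∉ N ∧
      (Nonempty ((G ⧸ (N : Subgroup G)) ≃* Multiplicative (ZMod 2)) ∨
        Nonempty ((G ⧸ (N : Subgroup G)) ≃* Multiplicative (ZMod 4)) ∨
        Nonempty ((G ⧸ (N : Subgroup G)) ≃* DihedralGroup 4)) := by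
  have h01 : ∀ t : ZMod 2, t ≠ 0 → t = 1 := by decide
  have h2 : ∀ t : ZMod 2, t + t = 0 := by decide
  by_cases hψ : ∃ x, ψ.val x ≠ 0 ∧ ψ'.val x ≠ 0
  · obtain ⟨x, hx, hx'⟩ := hψ
    let Φ : G →* DihedralGroup 4 :=
      MonoidHom.mk' (fun x => dihedralOfUnitriangular (ψ.val x) (ψ'.val x) (c x)) fun x y => by
        rw [dihedralOfUnitriangular_mul, H1.val_mul, H1.val_mul, ← hc]
        congr 1
        linear_combination h2 (c (x * y)) - h2 (c x) - h2 (c y)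
    have hker : ∀ x, x ∈ Φ.ker ↔ ψ.val x = 0 ∧ ψ'.val x = 0 ∧ c x = 0 := fun x =>
      dihedralOfUnitriangular_eq_one_iff _ _ _
    have hopen : IsOpen (Φ.ker : Set G) := by
      have e : (Φ.ker : Set G) = ψ.val ⁻¹' {0} ∩ (ψ'.val ⁻¹' {0} ∩ c ⁻¹' {0}) :=
        Set.ext hker
      rw [e]
      exact ((isOpen_discrete _).preimage ψ.continuous_val).inter
        (((isOpen_discrete _).preimage ψ'.continuous_val).inter
          ((isOpen_discrete _).preimage c.continuous))
    have hord : orderOf (Φ x) = 4 := by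
      have e : Φ x = dihedralOfUnitriangular 1 1 (c x) := by
        rw [← congrArg₂ (dihedralOfUnitriangular · · (c x)) (h01 _ hx) (h01 _ hx')]
        rfl
      rw [e, orderOf_dihedralOfUnitriangular]
    refine ⟨openNormalKer Φ hopen, fun h => hg ((hker g).mp h).2.2, Or.inr ?_⟩
    have e : (G ⧸ Φ.ker) ≃* Φ.range := QuotientGroup.quotientKerEquivRange Φ
    rcases nonempty_mulEquiv_of_orderOf_eq_four Φ.range ⟨x, rfl⟩ hord with ⟨⟨f⟩⟩ | ⟨⟨f⟩⟩
    exacts [Or.inl ⟨e.trans f⟩, Or.inr ⟨e.trans f⟩]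
  · push Not at hψ
    -- If `ψ` is nonzero at `x` and `ψ'` at `y` but never both at one point, then both are nonzero
    -- at `x * y`, a contradiction.
    have hzero : ∀ x y, ψ.val x * ψ'.val y = 0 := by
      by_contra! hne
      obtain ⟨x, y, hxy⟩ := hne
      have hx : ψ.val x ≠ 0 := left_ne_zero_of_mul hxy
      have hy : ψ'.val y ≠ 0 := right_ne_zero_of_mul hxy
      have hy' : ψ.val y = 0 := by
        by_contra h
        exact hy (hψ y h)
      have h := hψ (x * y) (by rw [H1.val_mul, hy', add_zero]; exact hx)
      rw [H1.val_mul, hψ x hx, zero_add] at h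
      exact hy h
    obtain ⟨N, hN, h⟩ := exists_quotient_zmodTwo (H1.mk c c.continuous fun x y => by
      have h := hc x y
      rw [hzero] at h
      linear_combination -h) (g := g) hg
    exact ⟨N, hN, Or.inl h⟩

/-- Evaluation of an element of `H¹(G) ⊗ H¹(G)` at a pair of group elements. -/
def evalTensor (x y : G) : H1 2 G ⊗[ℤ] H1 2 G →+ ZMod 2 :=
  TensorProduct.liftAddHom
    (AddMonoidHom.mk' (fun ψ => AddMonoidHom.mk' (fun ψ' => ψ.val x * ψ'.val y)
        fun a b => by rw [H1.val_add, mul_add])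
      fun a b => AddMonoidHom.ext fun ψ' => by
        simp [H1.val_add, add_mul])
    fun n a b => by rw [map_zsmul, map_zsmul, AddMonoidHom.zsmul_apply]

theorem evalTensor_tmul (x y : G) (ψ ψ' : H1 2 G) :
    evalTensor x y (ψ ⊗ₜ ψ') = ψ.val x * ψ'.val y := rfl

/-- The cup product of an element of `H¹(G) ⊗ H¹(G)` vanishes if and only if the corresponding
function on `G × G` is a coboundary. -/
theorem cupHom_eq_zero_iff (t : H1 2 G ⊗[ℤ] H1 2 G) :
    cupHom 2 G t = 0 ↔
      ∃ c : C(G, ZMod 2), ∀ x y, c y - c (x * y) + c x = evalTensor x y t := by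
  obtain ⟨z, hz, hz'⟩ : ∃ z : Z2 2 G, H2.mk 2 G z = cupHom 2 G t ∧
      ∀ x y, z.1 (x, y) = evalTensor x y t := by
    induction t using TensorProduct.induction_on with
    | zero => exact ⟨0, by simp, fun x y => by rw [map_zero]; rfl⟩
    | tmul a b => exact ⟨cupCocycle a b, rfl, fun x y => rfl⟩
    | add s t hs ht =>
      obtain ⟨z, hz, hz'⟩ := hs
      obtain ⟨w, hw, hw'⟩ := ht
      exact ⟨z + w, by rw [map_add, map_add, hz, hw], fun x y => by
        rw [map_add, ← hz', ← hw']; rfl⟩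
  rw [← hz]
  have h : H2.mk 2 G z = 0 ↔ z ∈ (B2 2 G).addSubgroupOf (Z2 2 G) :=
    QuotientAddGroup.eq_zero_iff z
  rw [h, AddSubgroup.mem_addSubgroupOf]
  refine exists_congr fun c => forall_congr' fun x => forall_congr' fun y => ?_
  rw [← hz']
  exact eq_comm

/-- A separating statement for the coefficients: if every character and every cochain trivializing
a cup product of two characters vanishes at `g`, so does every cochain trivializing a sum of cup
products. -/
theorem eq_zero_of_forall_cup_eq_zero (hG : IsGaloisRelationType 2 G) {g : G}
    (hg : ∀ (ψ ψ' : H1 2 G) (c : C(G, ZMod 2)),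
      (∀ x y, c y - c (x * y) + c x = ψ.val x * ψ'.val y) → c g = 0)
    (t : H1 2 G ⊗[ℤ] H1 2 G) (f : C(G, ZMod 2))
    (hf : ∀ x y, f y - f (x * y) + f x = evalTensor x y t) : f g = 0 := by
  have ht : t ∈ (cupHom 2 G).ker := (cupHom_eq_zero_iff t).mpr ⟨f, hf⟩
  rw [← hG.ker_cup] at ht
  -- Trivializing cochains add along sums of tensors, so one vanishing at `g` can be assembled from
  -- the pure tensors.
  obtain ⟨c, hc, hcg⟩ : ∃ c : C(G, ZMod 2),
      (∀ x y, c y - c (x * y) + c x = evalTensor x y t) ∧ c g = 0 := by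
    clear hf
    induction ht using AddSubgroup.closure_induction with
    | mem s hs =>
      obtain ⟨⟨ψ, ψ', rfl⟩, hs⟩ := hs
      obtain ⟨c, hc⟩ := (cupHom_eq_zero_iff _).mp hs
      exact ⟨c, hc, hg ψ ψ' c hc⟩
    | zero => exact ⟨0, fun x y => by simp, rfl⟩
    | add s t _ _ hs ht =>
      obtain ⟨c, hc, hcg⟩ := hs
      obtain ⟨d, hd, hdg⟩ := ht
      refine ⟨c + d, fun x y => ?_, by simp [hcg, hdg]⟩
      rw [map_add, ← hc, ← hd]
      simp only [ContinuousMap.add_apply]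
      ring
    | neg s _ hs =>
      obtain ⟨c, hc, hcg⟩ := hs
      refine ⟨-c, fun x y => ?_, by simp [hcg]⟩
      rw [map_neg, ← hc]
      simp only [ContinuousMap.neg_apply]
      ring
  -- Two cochains with the same coboundary differ by a character, covered by `hg` with `ψ = ψ' = 0`.
  have h := hg 0 0 (f - c) fun x y => by
    have h1 := hf x y
    have h2 := hc x y
    have h3 : (0 : H1 2 G).val x = 0 := rfl
    rw [h3, zero_mul]
    simp only [ContinuousMap.sub_apply]
    linear_combination h1 - h2
  rw [ContinuousMap.sub_apply, hcg, sub_zero] at h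
  exact h

end

/-! ### Detecting elements in finite quotients -/

section

variable {G : Type*} [Group G] [TopologicalSpace G] [IsTopologicalGroup G] [CompactSpace G]

/-- An element outside an open normal subgroup containing the third term of the descending
`2`-central sequence is detected by a character or by a cochain whose coboundary is a sum of cup
products of characters. -/
theorem exists_cochain_ne_zero (N : OpenNormalSubgroup G)
    (hN : descendingCentral 2 G 3 ≤ (N : Subgroup G)) {g : G} (hg : g ∉ N) :
    ∃ (t : H1 2 G ⊗[ℤ] H1 2 G) (f : C(G, ZMod 2)),
      (∀ x y, f y - f (x * y) + f x = evalTensor x y t) ∧ f g ≠ 0 := by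
  have hfin : Finite (G ⧸ (N : Subgroup G)) :=
    Subgroup.quotient_finite_of_isOpen _ N.isOpen'
  have hdisc : DiscreteTopology (G ⧸ (N : Subgroup G)) :=
    QuotientGroup.discreteTopology N.isOpen'
  have hmk : Continuous (fun x : G => (x : G ⧸ (N : Subgroup G))) := continuous_quotient_mk'
  let K : Subgroup (G ⧸ (N : Subgroup G)) :=
    (descendingCentral 2 G 2).map (QuotientGroup.mk' (N : Subgroup G))
  have hsq : ∀ x : G ⧸ (N : Subgroup G), x * x ∈ K := by
    intro x
    obtain ⟨x, rfl⟩ := QuotientGroup.mk_surjective x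
    refine ⟨x ^ 2, pow_mem_descendingCentral (i := 0) (Subgroup.mem_top x), ?_⟩
    rw [sq]
    rfl
  have hcentral : ∀ k ∈ K, ∀ x, k * x = x * k := by
    rintro _ ⟨k, hk, rfl⟩ x
    obtain ⟨x, rfl⟩ := QuotientGroup.mk_surjective x
    have h := hN (commutator_mem_descendingCentral (i := 1) hk x)
    refine (QuotientGroup.eq.mpr ?_).symm
    have e : (x * k)⁻¹ * (k * x) = k⁻¹ * x⁻¹ * k * x := by group
    rw [e]
    exact h
  have hK : ∀ k ∈ K, k * k = 1 := by
    rintro _ ⟨k, hk, rfl⟩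
    have h := hN (pow_mem_descendingCentral (i := 1) hk)
    rw [sq] at h
    exact (QuotientGroup.eq_one_iff (k * k)).mpr h
  by_cases hgK : (g : G ⧸ (N : Subgroup G)) ∈ K
  · have hne : (⟨g, hgK⟩ : K) ∉ (⊥ : Subgroup K) := fun h =>
      hg ((QuotientGroup.eq_one_iff g).mp (congrArg Subtype.val (Subgroup.mem_bot.mp h)))
    obtain ⟨χ, hχ, -, hχg⟩ := exists_zmodTwo_character (⊥ : Subgroup K)
      (fun k => Subgroup.mem_bot.mpr (Subtype.ext (hK k k.2))) hne
    obtain ⟨V, _, _, π, hsurj, hπ, hker⟩ := exists_zmodTwo_quotient K hsq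
    classical
    -- Extension by zero; only the values on `K` play a role.
    let θ : G ⧸ (N : Subgroup G) → ZMod 2 := fun x => if h : x ∈ K then χ ⟨x, h⟩ else 0
    have hθ : ∀ k (hk : k ∈ K), θ k = χ ⟨k, hk⟩ := fun k hk => dif_pos hk
    obtain ⟨B, f, hf, hfK⟩ := exists_extension_bilinear hsurj hπ hker hcentral hK θ
      fun k hk l hl => by
        rw [hθ _ hk, hθ _ hl, hθ _ (K.mul_mem hk hl), ← hχ]
        rfl
    have : Finite V := Finite.of_surjective π hsurj
    let b := Module.finBasis (ZMod 2) V
    let pull : (V →ₗ[ZMod 2] ZMod 2) → H1 2 G := fun φ =>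
      H1.mk (fun x => φ (π x))
        ((continuous_of_discreteTopology (f := fun q => φ (π q))).comp hmk)
        fun x y => by rw [QuotientGroup.mk_mul, hπ, map_add]
    -- The tensor is `B = ∑ bᵢ* ⊗ B(bᵢ, ·)` in a basis of `V`, pulled back to `G`.
    refine ⟨∑ i, pull (b.coord i) ⊗ₜ[ℤ] pull (B (b i)),
      ⟨fun x => f x, (continuous_of_discreteTopology (f := f)).comp hmk⟩, fun x y => ?_, ?_⟩
    · have hB : B (π x) (π y) = ∑ i, b.coord i (π x) * B (b i) (π y) := by
        conv_lhs => rw [← b.sum_repr (π x)]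
        simp only [map_sum, map_smul, LinearMap.sum_apply, LinearMap.smul_apply, smul_eq_mul,
          Module.Basis.coord_apply]
      have h := hf x y
      rw [map_sum]
      simp only [evalTensor_tmul]
      simp only [pull, H1.val_mk, ContinuousMap.coe_mk]
      rw [← hB, QuotientGroup.mk_mul]
      linear_combination h
    · change f g ≠ 0
      rw [hfK _ hgK, hθ _ hgK, hχg]
      exact one_ne_zero
  · obtain ⟨χ, hχ, -, hχg⟩ := exists_zmodTwo_character K hsq hgK
    refine ⟨0, ⟨fun x => χ x, (continuous_of_discreteTopology (f := χ)).comp hmk⟩,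
      fun x y => ?_, ?_⟩
    · simp only [ContinuousMap.coe_mk, map_zero, QuotientGroup.mk_mul, hχ]
      ring
    · change χ g ≠ 0
      rw [hχg]
      exact one_ne_zero

end

end ProfiniteCohomology

/-! ### The intersection theorem -/

/-- A point outside a closed normal subgroup of a profinite group is outside some open normal
subgroup containing it. -/
theorem exists_openNormalSubgroup_notMem {G : Type*} [Group G] [TopologicalSpace G]
    [IsTopologicalGroup G] [CompactSpace G] [TotallyDisconnectedSpace G] (H : Subgroup G)
    [H.Normal] (hH : IsClosed (H : Set G)) {g : G} (hg : g ∉ H) :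
    ∃ N : OpenNormalSubgroup G, H ≤ (N : Subgroup G) ∧ g ∉ N := by
  -- `U` is chosen with `gU` disjoint from `H`; then `g` is not in the open normal subgroup `HU`.
  obtain ⟨U, hU⟩ := ProfiniteGrp.exist_openNormalSubgroup_sub_open_nhds_of_one
    (U := {x | g * x ∉ H}) (hH.isOpen_compl.preimage (continuous_const_mul g)) (by simpa using hg)
  refine ⟨{ toSubgroup := H ⊔ (U : Subgroup G)
            isOpen' := Subgroup.isOpen_mono le_sup_right U.isOpen'
            isNormal' := inferInstance }, le_sup_left, fun h => ?_⟩
  obtain ⟨y, hy, z, hz, hyz⟩ := Subgroup.mem_sup_of_normal_left.mp h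
  refine hU (inv_mem hz : z⁻¹ ∈ U) ?_
  rw [← hyz, mul_inv_cancel_right]
  exact hy

/-- For `p = 2` and a profinite group `G` of Galois relation type, `G⁽³⁾` is the intersection of all
open normal subgroups `N` with `G ⧸ N` isomorphic to `1`, `ℤ/2`, `ℤ/4` or `D₄` (of order 8). -/
theorem corollary11p3 (G : Type*) [Group G] [TopologicalSpace G] [IsTopologicalGroup G]
    [CompactSpace G] [T2Space G] [TotallyDisconnectedSpace G]
    (hG : ProfiniteCohomology.IsGaloisRelationType 2 G) :
    descendingCentral 2 G 3 =
      ⨅ (N : OpenNormalSubgroup G)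
        (_ : Nonempty ((G ⧸ (N : Subgroup G)) ≃* Unit) ∨
          Nonempty ((G ⧸ (N : Subgroup G)) ≃* Multiplicative (ZMod 2)) ∨
          Nonempty ((G ⧸ (N : Subgroup G)) ≃* Multiplicative (ZMod 4)) ∨
          Nonempty ((G ⧸ (N : Subgroup G)) ≃* DihedralGroup 4)),
        (N : Subgroup G) := by
  refine le_antisymm (le_iInf₂ fun N hN => descendingCentral_three_le N ?_) fun g hg => ?_
  · rcases hN with ⟨⟨e⟩⟩ | ⟨⟨e⟩⟩ | ⟨⟨e⟩⟩ | ⟨⟨e⟩⟩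
    · exact .of_mulEquiv (.of_forall_pow_four fun _ => rfl) e
    · exact .of_mulEquiv (.of_forall_pow_four (by decide)) e
    · exact .of_mulEquiv (.of_forall_pow_four (by decide)) e
    · exact .of_mulEquiv squaresCommutatorsCentral_dihedral e
  · by_contra hg3
    -- The first `2` is the exponent; the second is an index shifted by one, denoting the third
    -- term.
    have := descendingCentral_normal (G := G) 2 2
    obtain ⟨N, hN, hgN⟩ :=
      exists_openNormalSubgroup_notMem _ (isClosed_descendingCentral 2 2) hg3
    obtain ⟨t, f, hf, hfg⟩ := ProfiniteCohomology.exists_cochain_ne_zero N hN hgN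
    refine hfg (ProfiniteCohomology.eq_zero_of_forall_cup_eq_zero hG (fun ψ ψ' c hc => ?_) t f hf)
    by_contra hcg
    obtain ⟨M, hM, hquot⟩ := ProfiniteCohomology.exists_quotient_of_cup ψ ψ' c hc hcg
    exact hM ((Subgroup.mem_iInf.mp ((Subgroup.mem_iInf.mp hg) M)) (Or.inr hquot))
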